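/- Let $(X_1,X_2,X_3)$ and $(U_1,U_2,U_3)$ be two independent triples of real-valued random variables on a probability space $(\Omega,\mathcal A,P)$, with $(U_1,U_2,U_3)$ uniformly distributed on $(0,1)^3$. Let $F_3$ be the distribution function of $X_3$, and for $i=1,2$ let $F_{i|3}(\cdot\,|\,x)$ be a version of the conditional distribution function of $X_i$ given $X_3=x$, i.e. for $PX_3^{-1}$-almost every $x$ it is the distribution function of the regular conditional distribution of $X_i$ given $X_3=x$. Write $F(x-)$ for the left limit of $F$ at $x$, and assume that the four maps $(x_i,x_3)\mapsto F_{i|3}(x_i\,|\,x_3)$ and $(x_i,x_3)\mapsto F_{i|3}(x_i-\,|\,x_3)$, $i=1,2$, are Borel measurable on $\mathbb R^2$. Define the Brockwell transforms $$Z_{i|3}=(1-U_i)\,F_{i|3}(X_i-\,|\,X_3)+U_i\,F_{i|3}(X_i\,|\,X_3)\quad(i=1,2),\qquad Z_3=(1-U_3)\,F_3(X_3-)+U_3\,F_3(X_3).$$ A distribution function $F$ is said to satisfy the $\le$ well-ordering condition if its set of jumps $D_F=\{x\in\mathbb R: F(x-)<F(x)\}$ is well-ordered by the usual order $\le$ of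 $\mathbb R$. Then: 1. If $X_1$ and $X_2$ are conditionally independent given $X_3$, then $Z_{1|3},Z_{2|3},Z_3$ are mutually independent. 2. Conversely, suppose that $F_3$ satisfies the $\le$ well-ordering condition and that, for $PX_3^{-1}$-almost every $x\in\mathbb R$, both $F_{1|3}(\cdot\,|\,x)$ and $F_{2|3}(\cdot\,|\,x)$ satisfy it. If $Z_{1|3},Z_{2|3},Z_3$ are mutually independent, then $X_1$ and $X_2$ are conditionally independent given $X_3$. -/

import Mathlib

open MeasureTheory ProbabilityTheory Set

noncomputable section

namespace Brockwell

/-- The left limit `F(x-)`. -/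
def leftLimit (F : ℝ → ℝ) (x : ℝ) : ℝ := Function.leftLim F x

/-- The set `D_F` of (jump) discontinuities of a distribution function `F`. -/
def jumpSet (F : ℝ → ℝ) : Set ℝ := {x | leftLimit F x < F x}

/-- The `≤` well-ordering condition: the set of jumps of `F` is well-ordered by the usual order
of the real line (for a subset of a linear order this is well-foundedness of `<`, i.e. every
nonempty subset has a least element). -/
def WellOrderingCondition (F : ℝ → ℝ) : Prop := (jumpSet F).IsWF

/-- The value `(1 - u) F(x-) + u F(x)` of the Brockwell transform with distribution function `F`. -/
def transform (F : ℝ → ℝ) (x u : ℝ) : ℝ := (1 - u) * leftLimit F x + u * F x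

variable {Ω : Type*} [MeasurableSpace Ω]

/-- The distribution function of a real random variable `X`. -/
def distFun (P : Measure Ω) (X : Ω → ℝ) : ℝ → ℝ := fun x => cdf (P.map X) x

/-- `F` (written `F x y` for `F(x | y)`) is a conditional distribution function of `X` given `Y`:
for almost every `y` (with respect to the law of `Y`), `F(· | y)` is the distribution function of
the regular conditional distribution of `X` given `Y = y`. Since regular conditional distributions
are unique up to null sets, this covers every version; the values on a null set of `y` are
unrestricted. -/
def IsCondDistFun (P : Measure Ω) [IsProbabilityMeasure P] (X Y : Ω → ℝ) (F : ℝ → ℝ → ℝ) : Prop :=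
  ∀ᵐ y ∂(P.map Y), ∀ x, F x y = cdf (condDistrib X Y P y) x

/-- `X` and `Y` are conditionally independent given `W`:
`P(X ∈ A, Y ∈ B | W) = P(X ∈ A | W) P(Y ∈ B | W)` almost surely, for all Borel sets `A`, `B`.
(Mathlib's `CondIndepFun` requires a standard Borel sample space.) -/
def CondIndepGiven (P : Measure Ω) (X Y W : Ω → ℝ) : Prop :=
  ∀ A B : Set ℝ, MeasurableSet A → MeasurableSet B →
    P⟦X ⁻¹' A ∩ Y ⁻¹' B | MeasurableSpace.comap W inferInstance⟧ =ᵐ[P]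
      fun ω => (P⟦X ⁻¹' A | MeasurableSpace.comap W inferInstance⟧) ω *
        (P⟦Y ⁻¹' B | MeasurableSpace.comap W inferInstance⟧) ω

/-- The Brockwell transform of `X` given `Y`, randomized by `U`. -/
def condBrockwell (F : ℝ → ℝ → ℝ) (X Y U : Ω → ℝ) : Ω → ℝ :=
  fun ω => transform (fun x => F x (Y ω)) (X ω) (U ω)

/-- The Brockwell transform of `X`, randomized by `U`. -/
def brockwell (P : Measure Ω) (X U : Ω → ℝ) : Ω → ℝ :=
  fun ω => transform (distFun P X) (X ω) (U ω)

end Brockwell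

end

noncomputable section

namespace Brockwell

open Filter Topology

/-! For one law with distribution function `F`, let `q` be a `z`-quantile. Up to null events, the
transform is at most `z` when `X < q`, or when `X = q` and `U` takes the matching fraction of the
jump at `q`. The total mass is `z`, so the transform is uniform (`map_transform_cdf`). Applied to
each conditional law given `X₃ = y`, this yields a law that does not depend on `y`: each `Z_{i|3}`
is uniform and independent of `X₃` (`map_condBrockwell_prodMk`).

Part 1: under conditional independence the fibre over `y` is a product. Its first two factors
integrate to constants, and integrating the third over `y` leaves a product of uniform laws.

Part 2: no information is lost, because `{X ≤ a}` is almost surely `{Z ≤ F(a | Y)}`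
(`ae_le_iff_condBrockwell_le`): one inclusion is pointwise and the two probabilities agree. Hence
independence from `Z₃` passes to `X₃`, the triple `(Z_{1|3}, Z_{2|3}, X₃)` has a product law, and
the events `{X₁ ≤ a, X₂ ≤ b, X₃ ∈ C}` have mass `∫_C F₁₃(a | y) F₂₃(b | y)`. -/

/-! ### The uniform law and its characterization by half-lines. -/

/-- The uniform distribution on `(0, 1)`. -/
abbrev unif : Measure ℝ := volume.restrict (Ioo (0 : ℝ) 1)

instance unif_isProbabilityMeasure : IsProbabilityMeasure unif :=
  ⟨by simp⟩

lemma unif_ae_mem : ∀ᵐ u ∂unif, u ∈ Ioo (0 : ℝ) 1 :=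
  ae_restrict_mem measurableSet_Ioo

lemma unif_Iic {a : ℝ} (h1 : a ≤ 1) : unif (Iic a) = ENNReal.ofReal a := by
  rw [Measure.restrict_apply measurableSet_Iic]
  apply le_antisymm
  · calc volume (Iic a ∩ Ioo 0 1) ≤ volume (Ioc 0 a) :=
          measure_mono fun x ⟨hx, hx'⟩ => ⟨hx'.1, hx⟩
      _ = _ := by simp
  · calc ENNReal.ofReal a = volume (Ioo 0 a) := by simp
      _ ≤ volume (Iic a ∩ Ioo 0 1) := measure_mono fun x ⟨hx, hx'⟩ => ⟨hx'.le, hx, hx'.trans_le h1⟩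

lemma unif_Iic_of_nonpos {a : ℝ} (h : a ≤ 0) : unif (Iic a) = 0 := by
  refine le_antisymm ?_ zero_le
  calc unif (Iic a) ≤ unif (Iic 0) := measure_mono (Iic_subset_Iic.2 h)
    _ = 0 := by rw [unif_Iic zero_le_one]; simp

lemma unif_Iic_of_one_le {a : ℝ} (h : 1 ≤ a) : unif (Iic a) = 1 := by
  refine le_antisymm prob_le_one ?_
  calc (1 : ENNReal) = unif (Iic 1) := by rw [unif_Iic le_rfl]; simp
    _ ≤ _ := measure_mono (Iic_subset_Iic.2 h)

/-- Serves for an atom of mass `d`, of which the randomization must keep exactly the mass `c`; if `d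
= 0`, both sides vanish. -/
lemma ofReal_mul_unif {c d : ℝ} (hc : 0 ≤ c) (hcd : c ≤ d) :
    ENNReal.ofReal d * unif {u | u * d ≤ c} = ENNReal.ofReal c := by
  rcases (hc.trans hcd).eq_or_lt with h | h
  · have : c = 0 := by linarith
    simp [this, ← h]
  · have : {u : ℝ | u * d ≤ c} = Iic (c / d) := by
      ext u; simp [le_div_iff₀ h]
    rw [this, unif_Iic ((div_le_one h).2 hcd), ← ENNReal.ofReal_mul h.le]
    congr 1
    field_simp

/-- A probability measure on `ℝ` whose distribution function is squeezed to be the identity on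
`(0, 1)` is the uniform distribution. -/
lemma eq_unif_of_le (m : Measure ℝ) [IsProbabilityMeasure m]
    (h1 : ∀ z ∈ Ioo (0 : ℝ) 1, ENNReal.ofReal z ≤ m (Iic z))
    (h2 : ∀ z ∈ Ioo (0 : ℝ) 1, m (Iio z) ≤ ENNReal.ofReal z) : m = unif := by
  refine Measure.ext_of_Iic _ _ fun a => ?_
  -- Letting `z` decrease to `b` turns the bound on open half-lines into one on closed half-lines.
  have hupper : ∀ b : ℝ, 0 ≤ b → b < 1 → m (Iic b) ≤ ENNReal.ofReal b := fun b h0 h => by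
    have hof : Tendsto (fun z : ℝ => ENNReal.ofReal z) (𝓝[>] b) (𝓝 (ENNReal.ofReal b)) :=
      (ENNReal.continuous_ofReal.tendsto b).mono_left nhdsWithin_le_nhds
    refine ge_of_tendsto hof ?_
    filter_upwards [Ioo_mem_nhdsGT h] with z hz
    exact (measure_mono (Iic_subset_Iio.2 hz.1)).trans (h2 z ⟨h0.trans_lt hz.1, hz.2⟩)
  rcases le_or_gt a 0 with h | h
  · rw [unif_Iic_of_nonpos h]
    refine le_antisymm ?_ zero_le
    calc m (Iic a) ≤ m (Iic 0) := measure_mono (Iic_subset_Iic.2 h)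
      _ ≤ ENNReal.ofReal 0 := hupper 0 le_rfl one_pos
      _ = 0 := ENNReal.ofReal_zero
  rcases lt_or_ge a 1 with h' | h'
  · rw [unif_Iic h'.le]
    exact le_antisymm (hupper a h.le h') (h1 a ⟨h, h'⟩)
  · rw [unif_Iic_of_one_le h']
    refine le_antisymm prob_le_one ?_
    have hof : Tendsto (fun z : ℝ => ENNReal.ofReal z) (𝓝[<] 1) (𝓝 (ENNReal.ofReal 1)) :=
      (ENNReal.continuous_ofReal.tendsto 1).mono_left nhdsWithin_le_nhds
    rw [ENNReal.ofReal_one] at hof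
    refine le_of_tendsto hof ?_
    filter_upwards [Ioo_mem_nhdsLT one_pos] with z hz
    exact (h1 z hz).trans (measure_mono (Iic_subset_Iic.2 (hz.2.le.trans h')))

/-! ### Quantiles and uniformity of the Brockwell transform. -/

/-- For every level in `(0, 1)`, a distribution function has a quantile. -/
lemma exists_quantile (ν : Measure ℝ) {z : ℝ} (hz : z ∈ Ioo (0 : ℝ) 1) :
    ∃ q, leftLimit (cdf ν) q ≤ z ∧ z ≤ cdf ν q ∧ ∀ x < q, cdf ν x < z := by
  set S : Set ℝ := {t | z ≤ cdf ν t}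
  have hne : S.Nonempty :=
    (((tendsto_cdf_atTop ν).eventually (lt_mem_nhds hz.2)).exists).imp fun _ h => h.le
  have hbdd : BddBelow S := by
    obtain ⟨b, hb⟩ := ((tendsto_cdf_atBot ν).eventually (gt_mem_nhds hz.1)).exists
    refine ⟨b, fun t ht => ?_⟩
    by_contra! h
    exact absurd (ht.trans (monotone_cdf ν h.le)) (not_le.2 hb)
  have hlt : ∀ x < sInf S, cdf ν x < z := fun x hx => by
    by_contra! h
    exact absurd (csInf_le hbdd h) (not_le.2 hx)
  refine ⟨sInf S, ?_, ?_, hlt⟩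
  · have := (monotone_cdf ν).tendsto_leftLim (sInf S)
    refine le_of_tendsto this ?_
    filter_upwards [self_mem_nhdsWithin] with x hx using (hlt x hx).le
  · have h := ((cdf ν).right_continuous (sInf S)).tendsto
    have h' : Tendsto (cdf ν) (𝓝[>] sInf S) (𝓝 (cdf ν (sInf S))) :=
      h.mono_left (nhdsWithin_mono _ Ioi_subset_Ici_self)
    refine ge_of_tendsto h' ?_
    filter_upwards [self_mem_nhdsWithin] with x hx
    obtain ⟨t, ht, htx⟩ := exists_lt_of_csInf_lt hne hx
    exact le_trans ht (monotone_cdf ν htx.le)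

lemma leftLimit_le_cdf (ν : Measure ℝ) (x : ℝ) : leftLimit (cdf ν) x ≤ cdf ν x :=
  (monotone_cdf ν).leftLim_le le_rfl

lemma leftLimit_cdf_nonneg (ν : Measure ℝ) (x : ℝ) : 0 ≤ leftLimit (cdf ν) x :=
  (cdf_nonneg ν (x - 1)).trans ((monotone_cdf ν).le_leftLim (by linarith))

lemma transform_le_cdf (ν : Measure ℝ) (x : ℝ) {u : ℝ} (hu : u ∈ Ioo (0 : ℝ) 1) :
    transform (cdf ν) x u ≤ cdf ν x := by
  have := leftLimit_le_cdf ν x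
  unfold transform
  nlinarith [hu.2]

lemma leftLimit_le_transform (ν : Measure ℝ) (x : ℝ) {u : ℝ} (hu : u ∈ Ioo (0 : ℝ) 1) :
    leftLimit (cdf ν) x ≤ transform (cdf ν) x u := by
  have := leftLimit_le_cdf ν x
  unfold transform
  nlinarith [hu.1]

lemma measurable_transform_cdf (ν : Measure ℝ) :
    Measurable fun p : ℝ × ℝ => transform (cdf ν) p.1 p.2 := by
  have h1 : Measurable (cdf ν) := (monotone_cdf ν).measurable
  have h2 : Measurable (leftLimit (cdf ν)) := (monotone_cdf ν).leftLim.measurable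
  unfold transform
  fun_prop

/-- The Brockwell transform of a random variable with law `ν` is uniform on `(0, 1)`. -/
theorem map_transform_cdf (ν : Measure ℝ) [IsProbabilityMeasure ν] :
    (ν.prod unif).map (fun p : ℝ × ℝ => transform (cdf ν) p.1 p.2) = unif := by
  have hT := measurable_transform_cdf ν
  have : IsProbabilityMeasure
      ((ν.prod unif).map (fun p : ℝ × ℝ => transform (cdf ν) p.1 p.2)) :=
    Measure.isProbabilityMeasure_map hT.aemeasurable
  have hae : ∀ᵐ p ∂(ν.prod unif), p.2 ∈ Ioo (0 : ℝ) 1 :=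
    Measure.quasiMeasurePreserving_snd.ae unif_ae_mem
  have hIio : ∀ q, ν (Iio q) = ENNReal.ofReal (leftLimit (cdf ν) q) := fun q => by
    conv_lhs => rw [← measure_cdf ν]
    rw [StieltjesFunction.measure_Iio _ (tendsto_cdf_atBot ν), sub_zero]; rfl
  have hsing : ∀ q, ν {q} = ENNReal.ofReal (cdf ν q - leftLimit (cdf ν) q) := fun q => by
    conv_lhs => rw [← measure_cdf ν]
    rw [StieltjesFunction.measure_singleton]; rfl
  -- This set of mass `z` lies between `{transform < z}` and `{transform ≤ z}` almost everywhere,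
  -- which is all that `eq_unif_of_le` requires.
  have hval : ∀ z ∈ Ioo (0 : ℝ) 1, ∃ q, z ≤ cdf ν q ∧ (∀ x < q, cdf ν x < z) ∧
      (ν.prod unif) (Iio q ×ˢ univ ∪ {q} ×ˢ {u | u * (cdf ν q - leftLimit (cdf ν) q)
        ≤ z - leftLimit (cdf ν) q}) = ENNReal.ofReal z := fun z hz => by
    obtain ⟨q, hq1, hq2, hq3⟩ := exists_quantile ν hz
    refine ⟨q, hq2, hq3, ?_⟩
    rw [measure_union, Measure.prod_prod, Measure.prod_prod, hIio, hsing,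
      ofReal_mul_unif (by linarith) (by linarith), measure_univ, mul_one,
      ← ENNReal.ofReal_add (leftLimit_cdf_nonneg ν q) (by linarith)]
    · congr 1; ring
    · refine Set.disjoint_left.2 fun p hp hp' => ?_
      have h1 : p.1 < q := hp.1
      have h2 : p.1 = q := hp'.1
      exact h1.ne h2
    · exact (measurableSet_singleton q).prod
        (measurableSet_le (by fun_prop) measurable_const)
  refine eq_unif_of_le _ (fun z hz => ?_) (fun z hz => ?_)
  · obtain ⟨q, -, hq3, hq⟩ := hval z hz
    rw [Measure.map_apply hT measurableSet_Iic, ← hq]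
    refine measure_mono_ae ?_
    filter_upwards [hae] with p hp hmem
    rcases hmem with h | h
    · exact (transform_le_cdf ν p.1 hp).trans (hq3 _ h.1).le
    · have h1 : p.1 = q := h.1
      have h2 : p.2 * (cdf ν q - leftLimit (cdf ν) q) ≤ z - leftLimit (cdf ν) q := h.2
      change transform (cdf ν) p.1 p.2 ≤ z
      rw [h1, transform]
      linarith
  · obtain ⟨q, hq2, -, hq⟩ := hval z hz
    rw [Measure.map_apply hT measurableSet_Iio, ← hq]
    refine measure_mono_ae ?_
    filter_upwards [hae] with p hp hmem
    replace hmem : transform (cdf ν) p.1 p.2 < z := hmem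
    rcases lt_trichotomy p.1 q with h | h | h
    · exact Or.inl ⟨h, trivial⟩
    · refine Or.inr ⟨h, ?_⟩
      rw [h, transform] at hmem
      change p.2 * (cdf ν q - leftLimit (cdf ν) q) ≤ z - leftLimit (cdf ν) q
      linarith
    -- To the right of `q` the transform is at least `F(q) ≥ z`; equality is possible, hence the
    -- strict inequality in this half.
    · have h1 : cdf ν q ≤ leftLimit (cdf ν) p.1 := (monotone_cdf ν).le_leftLim h
      have h2 := leftLimit_le_transform ν p.1 hp
      linarith

/-- Integral form of `map_transform_cdf`. -/
lemma lintegral_unif_transform_cdf (ν : Measure ℝ) [IsProbabilityMeasure ν] {A : Set ℝ}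
    (hA : MeasurableSet A) :
    ∫⁻ x, unif {u | transform (cdf ν) x u ∈ A} ∂ν = unif A := by
  conv_rhs => rw [← map_transform_cdf ν]
  rw [Measure.map_apply (measurable_transform_cdf ν) hA,
    Measure.prod_apply (measurable_transform_cdf ν hA)]
  rfl

/-! ### Conditional independence in terms of conditional laws. -/

variable {Ω : Type*} [MeasurableSpace Ω]

/-- Conditional probabilities given `W` are values of `condDistrib` at `W`, so the defining identity
is an almost everywhere equality of two functions of `W`, which can be tested by integrating over
every Borel set `C`. -/
lemma condIndepGiven_iff (P : Measure Ω) [IsProbabilityMeasure P] {X Y W : Ω → ℝ}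
    (hX : Measurable X) (hY : Measurable Y) (hW : Measurable W) :
    CondIndepGiven P X Y W ↔ ∀ A B C : Set ℝ, MeasurableSet A → MeasurableSet B →
      MeasurableSet C → P (X ⁻¹' A ∩ Y ⁻¹' B ∩ W ⁻¹' C) =
        ∫⁻ y in C, condDistrib X W P y A * condDistrib Y W P y B ∂(P.map W) := by
  have key : ∀ A B : Set ℝ, MeasurableSet A → MeasurableSet B →
      ((P⟦X ⁻¹' A ∩ Y ⁻¹' B | MeasurableSpace.comap W inferInstance⟧ =ᵐ[P]
        fun ω => (P⟦X ⁻¹' A | MeasurableSpace.comap W inferInstance⟧) ω *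
          (P⟦Y ⁻¹' B | MeasurableSpace.comap W inferInstance⟧) ω) ↔
      ∀ C : Set ℝ, MeasurableSet C → P (X ⁻¹' A ∩ Y ⁻¹' B ∩ W ⁻¹' C) =
        ∫⁻ y in C, condDistrib X W P y A * condDistrib Y W P y B ∂(P.map W)) := by
    intro A B hA hB
    have hXY : Measurable fun ω => (X ω, Y ω) := hX.prodMk hY
    set Q := condDistrib (fun ω => (X ω, Y ω)) W P
    have hQ : Measurable fun y => Q y (A ×ˢ B) := Kernel.measurable_coe _ (hA.prod hB)
    have hXA : Measurable fun y => condDistrib X W P y A := Kernel.measurable_coe _ hA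
    have hYB : Measurable fun y => condDistrib Y W P y B := Kernel.measurable_coe _ hB
    have hprod : Measurable fun y => condDistrib X W P y A * condDistrib Y W P y B :=
      hXA.mul hYB
    have eXY := condDistrib_ae_eq_condExp (μ := P) hW hXY (hA.prod hB)
    have eX := condDistrib_ae_eq_condExp (μ := P) hW hX hA
    have eY := condDistrib_ae_eq_condExp (μ := P) hW hY hB
    have hpre : (fun ω => (X ω, Y ω)) ⁻¹' (A ×ˢ B) = X ⁻¹' A ∩ Y ⁻¹' B := rfl
    rw [hpre] at eXY
    have hae : (P⟦X ⁻¹' A ∩ Y ⁻¹' B | MeasurableSpace.comap W inferInstance⟧ =ᵐ[P]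
        fun ω => (P⟦X ⁻¹' A | MeasurableSpace.comap W inferInstance⟧) ω *
          (P⟦Y ⁻¹' B | MeasurableSpace.comap W inferInstance⟧) ω) ↔
        (fun y => Q y (A ×ˢ B)) =ᵐ[P.map W]
          fun y => condDistrib X W P y A * condDistrib Y W P y B := by
      rw [Filter.EventuallyEq, Filter.EventuallyEq,
        ae_map_iff hW.aemeasurable (measurableSet_eq_fun hQ hprod)]
      refine Filter.eventually_congr ?_
      filter_upwards [eXY, eX, eY] with ω h h1 h2
      rw [← h, ← h1, ← h2, measureReal_def, measureReal_def, measureReal_def,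
        ← ENNReal.toReal_mul, ENNReal.toReal_eq_toReal_iff' (measure_ne_top _ _)
          (ENNReal.mul_ne_top (measure_ne_top _ _) (measure_ne_top _ _))]
    have hint : ∀ C : Set ℝ, MeasurableSet C →
        P (X ⁻¹' A ∩ Y ⁻¹' B ∩ W ⁻¹' C) = ∫⁻ y in C, Q y (A ×ˢ B) ∂(P.map W) := fun C hC => by
      rw [setLIntegral_map hC hQ hW,
        setLIntegral_preimage_condDistrib hW hXY.aemeasurable (hA.prod hB) hC, hpre,
        inter_comm]
    rw [hae]
    constructor
    · intro h C hC
      rw [hint C hC]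
      exact lintegral_congr_ae (ae_restrict_of_ae h)
    · intro h
      refine ae_eq_of_forall_setLIntegral_eq_of_sigmaFinite hQ hprod fun C hC _ => ?_
      rw [← hint C hC, h C hC]
  constructor
  · exact fun h A B C hA hB hC => (key A B hA hB).1 (h A B hA hB) C hC
  · exact fun h A B hA hB => (key A B hA hB).2 fun C hC => h A B C hA hB hC

/-- Under conditional independence, the joint law disintegrates through the product of the
conditional laws. -/
lemma CondIndepGiven.map_eq_compProd {P : Measure Ω} [IsProbabilityMeasure P] {X Y W : Ω → ℝ}
    (hX : Measurable X) (hY : Measurable Y) (hW : Measurable W) (h : CondIndepGiven P X Y W) :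
    P.map (fun ω => (W ω, X ω, Y ω)) =
      P.map W ⊗ₘ (condDistrib X W P ×ₖ condDistrib Y W P) := by
  refine Measure.ext_prod₃ fun {C A B} hC hA hB => ?_
  rw [Measure.map_apply (by fun_prop) (hC.prod (hA.prod hB)),
    Measure.compProd_apply_prod hC (hA.prod hB)]
  simp_rw [Kernel.prod_apply, Measure.prod_prod]
  rw [← (condIndepGiven_iff P hX hY hW).1 h A B C hA hB hC]
  congr 1
  ext ω
  simp only [mem_preimage, mem_prod, mem_inter_iff]
  tauto

/-- Two finite measures agreeing on the events `{f ≤ a} ∩ S` agree on all events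
`{f ∈ A} ∩ S`. -/
lemma measure_preimage_inter_eq_of_Iic {μ₁ μ₂ : Measure Ω} [IsFiniteMeasure μ₁]
    [IsFiniteMeasure μ₂] {f : Ω → ℝ} (hf : Measurable f) {S : Set Ω}
    (h : ∀ a, μ₁ (f ⁻¹' Iic a ∩ S) = μ₂ (f ⁻¹' Iic a ∩ S)) {A : Set ℝ} (hA : MeasurableSet A) :
    μ₁ (f ⁻¹' A ∩ S) = μ₂ (f ⁻¹' A ∩ S) := by
  have h' : (μ₁.restrict S).map f = (μ₂.restrict S).map f := by
    refine Measure.ext_of_Iic _ _ fun a => ?_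
    rw [Measure.map_apply hf measurableSet_Iic, Measure.map_apply hf measurableSet_Iic,
      Measure.restrict_apply (hf measurableSet_Iic),
      Measure.restrict_apply (hf measurableSet_Iic), h a]
  have := congrArg (fun m => m A) h'
  simpa only [Measure.map_apply hf hA, Measure.restrict_apply (hf hA)] using this

/-- Both sides are finite measures of boxes `C ×ˢ A ×ˢ B`. Half-lines determine such measures, one
coordinate at a time: first `A` with `B` arbitrary, then `B` with `A` a half-line. -/
lemma condIndepGiven_of_Iic {P : Measure Ω} [IsProbabilityMeasure P] {X Y W : Ω → ℝ}
    (hX : Measurable X) (hY : Measurable Y) (hW : Measurable W)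
    (h : ∀ (a b : ℝ) (C : Set ℝ), MeasurableSet C →
      P (X ⁻¹' Iic a ∩ Y ⁻¹' Iic b ∩ W ⁻¹' C) =
        ∫⁻ y in C, condDistrib X W P y (Iic a) * condDistrib Y W P y (Iic b) ∂(P.map W)) :
    CondIndepGiven P X Y W := by
  rw [condIndepGiven_iff P hX hY hW]
  have : IsProbabilityMeasure (P.map W) := Measure.isProbabilityMeasure_map hW.aemeasurable
  intro A B C hA hB hC
  have e (C A B : Set ℝ) : (fun ω => (W ω, X ω, Y ω)) ⁻¹' (C ×ˢ A ×ˢ B) =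
      X ⁻¹' A ∩ Y ⁻¹' B ∩ W ⁻¹' C := by
    ext ω
    simp only [mem_preimage, mem_prod, mem_inter_iff]
    tauto
  have hm : Measurable fun ω => (W ω, X ω, Y ω) := by fun_prop
  set κ := condDistrib X W P ×ₖ condDistrib Y W P
  have hκ (C A B : Set ℝ) (hC : MeasurableSet C) (hA : MeasurableSet A) (hB : MeasurableSet B) :
      (P.map W ⊗ₘ κ) (C ×ˢ A ×ˢ B) =
        ∫⁻ y in C, condDistrib X W P y A * condDistrib Y W P y B ∂(P.map W) := by
    rw [Measure.compProd_apply_prod hC (hA.prod hB)]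
    simp_rw [κ, Kernel.prod_apply, Measure.prod_prod]
  have hP (C A B : Set ℝ) (hC : MeasurableSet C) (hA : MeasurableSet A) (hB : MeasurableSet B) :
      P.map (fun ω => (W ω, X ω, Y ω)) (C ×ˢ A ×ˢ B) = P (X ⁻¹' A ∩ Y ⁻¹' B ∩ W ⁻¹' C) := by
    rw [Measure.map_apply hm (hC.prod (hA.prod hB)), e]
  have : IsProbabilityMeasure (P.map (fun ω => (W ω, X ω, Y ω))) :=
    Measure.isProbabilityMeasure_map hm.aemeasurable
  rw [← hP C A B hC hA hB, ← hκ C A B hC hA hB]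
  have e1 (A B : Set ℝ) : C ×ˢ A ×ˢ B = (fun p : ℝ × ℝ × ℝ => p.2.1) ⁻¹' A ∩ C ×ˢ univ ×ˢ B := by
    ext p
    simp only [mem_preimage, mem_prod, mem_inter_iff, mem_univ]
    tauto
  have e2 (A B : Set ℝ) : C ×ˢ A ×ˢ B = (fun p : ℝ × ℝ × ℝ => p.2.2) ⁻¹' B ∩ C ×ˢ A ×ˢ univ := by
    ext p
    simp only [mem_preimage, mem_prod, mem_inter_iff, mem_univ]
    tauto
  rw [e1]
  refine measure_preimage_inter_eq_of_Iic (by fun_prop) (fun a => ?_) hA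
  rw [← e1, e2]
  refine measure_preimage_inter_eq_of_Iic (by fun_prop) (fun b => ?_) hB
  rw [← e2, hP C _ _ hC measurableSet_Iic measurableSet_Iic,
    hκ C _ _ hC measurableSet_Iic measurableSet_Iic, h a b C hC]

/-! ### Randomization and measurability. -/

lemma map_eq_unif_prod {P : Measure Ω} {U : Ω → ℝ × ℝ × ℝ}
    (hU : pdf.IsUniform U (Ioo (0 : ℝ) 1 ×ˢ Ioo (0 : ℝ) 1 ×ˢ Ioo (0 : ℝ) 1) P volume) :
    P.map U = unif.prod (unif.prod unif) := by
  rw [show P.map U = _ from hU, ProbabilityTheory.cond, Measure.volume_eq_prod,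
    Measure.volume_eq_prod, Measure.prod_prod, Measure.prod_prod, unif, Measure.prod_restrict,
    Measure.prod_restrict]
  -- The cube has volume one, so the normalizing factor disappears.
  simp

/-- Randomizing three functionals of `X` by independent uniform variables. -/
lemma measure_randomized {E : Type*} [MeasurableSpace E] {P : Measure Ω} [IsProbabilityMeasure P]
    {X : Ω → E} {U₁ U₂ U₃ : Ω → ℝ} (hX : Measurable X)
    (hU₁ : Measurable U₁) (hU₂ : Measurable U₂) (hU₃ : Measurable U₃)
    (hXU : IndepFun X (fun ω => (U₁ ω, U₂ ω, U₃ ω)) P)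
    (hU : P.map (fun ω => (U₁ ω, U₂ ω, U₃ ω)) = unif.prod (unif.prod unif))
    {T₁ T₂ T₃ : E → ℝ → ℝ} (hT₁ : Measurable (Function.uncurry T₁))
    (hT₂ : Measurable (Function.uncurry T₂)) (hT₃ : Measurable (Function.uncurry T₃))
    {A B C : Set ℝ} (hA : MeasurableSet A) (hB : MeasurableSet B) (hC : MeasurableSet C) :
    P {ω | T₁ (X ω) (U₁ ω) ∈ A ∧ T₂ (X ω) (U₂ ω) ∈ B ∧ T₃ (X ω) (U₃ ω) ∈ C} =
      ∫⁻ x, unif {u | T₁ x u ∈ A} * (unif {u | T₂ x u ∈ B} * unif {u | T₃ x u ∈ C})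
        ∂(P.map X) := by
  have hUm : Measurable fun ω => (U₁ ω, U₂ ω, U₃ ω) := by fun_prop
  set S : Set (E × ℝ × ℝ × ℝ) :=
    {p | T₁ p.1 p.2.1 ∈ A ∧ T₂ p.1 p.2.2.1 ∈ B ∧ T₃ p.1 p.2.2.2 ∈ C}
  have hS : MeasurableSet S := by
    have h₁ : Measurable fun p : E × ℝ × ℝ × ℝ => T₁ p.1 p.2.1 :=
      hT₁.comp (measurable_fst.prodMk measurable_snd.fst)
    have h₂ : Measurable fun p : E × ℝ × ℝ × ℝ => T₂ p.1 p.2.2.1 :=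
      hT₂.comp (measurable_fst.prodMk measurable_snd.snd.fst)
    have h₃ : Measurable fun p : E × ℝ × ℝ × ℝ => T₃ p.1 p.2.2.2 :=
      hT₃.comp (measurable_fst.prodMk measurable_snd.snd.snd)
    exact (h₁ hA).inter ((h₂ hB).inter (h₃ hC))
  have hlaw := hXU.map_prod_eq_prod_map_map hX.aemeasurable hUm.aemeasurable
  have : IsProbabilityMeasure (P.map X) := Measure.isProbabilityMeasure_map hX.aemeasurable
  calc P {ω | T₁ (X ω) (U₁ ω) ∈ A ∧ T₂ (X ω) (U₂ ω) ∈ B ∧ T₃ (X ω) (U₃ ω) ∈ C}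
      = P.map (fun ω => (X ω, U₁ ω, U₂ ω, U₃ ω)) S :=
        (Measure.map_apply (hX.prodMk hUm) hS).symm
    _ = ∫⁻ x, (unif.prod (unif.prod unif)) (Prod.mk x ⁻¹' S) ∂(P.map X) := by
        rw [hlaw, hU, Measure.prod_apply hS]
    _ = _ := by
        refine lintegral_congr fun x => ?_
        rw [← Measure.prod_prod, ← Measure.prod_prod]
        rfl

lemma measurable_transform {F : ℝ → ℝ → ℝ}
    (hF : Measurable fun p : ℝ × ℝ => F p.1 p.2)
    (hF' : Measurable fun p : ℝ × ℝ => leftLimit (fun x => F x p.2) p.1)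
    {α : Type*} [MeasurableSpace α] {f g h : α → ℝ} (hf : Measurable f) (hg : Measurable g)
    (hh : Measurable h) : Measurable fun a => transform (fun t => F t (g a)) (f a) (h a) := by
  have h1 : Measurable fun a => F (f a) (g a) := hF.comp (hf.prodMk hg)
  have h2 : Measurable fun a => leftLimit (fun x => F x (g a)) (f a) := hF'.comp (hf.prodMk hg)
  unfold transform
  fun_prop

lemma IsCondDistFun.lintegral_unif_transform {P : Measure Ω} [IsProbabilityMeasure P]
    {X Y : Ω → ℝ} {F : ℝ → ℝ → ℝ} (hF : IsCondDistFun P X Y F) {A : Set ℝ}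
    (hA : MeasurableSet A) :
    ∀ᵐ y ∂(P.map Y), ∫⁻ x, unif {u | transform (fun t => F t y) x u ∈ A} ∂(condDistrib X Y P y) =
      unif A := by
  filter_upwards [hF] with y hy
  rw [funext hy]
  exact lintegral_unif_transform_cdf _ hA

/-- Converts events of a uniform transform back into events of `X`. The exceptional null set of `y`
is the same for every `a`. -/
lemma IsCondDistFun.unif_Iic {P : Measure Ω} [IsProbabilityMeasure P]
    {X Y : Ω → ℝ} {F : ℝ → ℝ → ℝ} (hF : IsCondDistFun P X Y F) :
    ∀ᵐ y ∂(P.map Y), ∀ a, unif (Iic (F a y)) = condDistrib X Y P y (Iic a) := by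
  filter_upwards [hF] with y hy a
  rw [hy, Brockwell.unif_Iic (cdf_le_one _ _), ofReal_cdf]

/-! ### The conditional Brockwell transform of a pair. -/

section Pair

variable {P : Measure Ω} [IsProbabilityMeasure P] {X Y U : Ω → ℝ} {F : ℝ → ℝ → ℝ}

/-- The conditional Brockwell transform is uniform and independent of the conditioning variable. -/
lemma map_condBrockwell_prodMk (hX : Measurable X) (hY : Measurable Y) (hU : Measurable U)
    (hind : IndepFun (fun ω => (X ω, Y ω)) U P) (hlaw : P.map U = unif)
    (hF : IsCondDistFun P X Y F) (hm : Measurable fun p : ℝ × ℝ => F p.1 p.2)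
    (hm' : Measurable fun p : ℝ × ℝ => leftLimit (fun x => F x p.2) p.1) :
    P.map (fun ω => (condBrockwell F X Y U ω, Y ω)) = unif.prod (P.map Y) := by
  have : IsProbabilityMeasure (P.map Y) := Measure.isProbabilityMeasure_map hY.aemeasurable
  have hZ : Measurable (condBrockwell F X Y U) := measurable_transform hm hm' hX hY hU
  have hYX : Measurable fun ω => (Y ω, X ω) := by fun_prop
  have : IsProbabilityMeasure (P.map fun ω => (Y ω, X ω)) :=
    Measure.isProbabilityMeasure_map hYX.aemeasurable
  -- The conditioning variable is put first to match the disintegration by `condDistrib`.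
  have hlawX := (hind.comp (φ := Prod.swap) measurable_swap measurable_id).map_prod_eq_prod_map_map
    hYX.aemeasurable hU.aemeasurable
  refine Measure.ext_prod fun {A C} hA hC => ?_
  have hT : Measurable fun p : (ℝ × ℝ) × ℝ => transform (fun t => F t p.1.1) p.1.2 p.2 :=
    measurable_transform hm hm' measurable_fst.snd measurable_fst.fst measurable_snd
  set S : Set ((ℝ × ℝ) × ℝ) := {p | transform (fun t => F t p.1.1) p.1.2 p.2 ∈ A}
  have hS : MeasurableSet S := hT hA
  have hh : Measurable fun p : ℝ × ℝ => unif {u | transform (fun t => F t p.1) p.2 u ∈ A} :=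
    measurable_measure_prodMk_left hS
  calc P.map (fun ω => (condBrockwell F X Y U ω, Y ω)) (A ×ˢ C)
      = P.map (fun ω => ((Y ω, X ω), U ω)) (S ∩ (C ×ˢ univ) ×ˢ univ) := by
        rw [Measure.map_apply (hZ.prodMk hY) (hA.prod hC), Measure.map_apply (hYX.prodMk hU)
          (hS.inter ((hC.prod .univ).prod .univ))]
        congr 1
        ext ω
        simp [S, condBrockwell]
    _ = ∫⁻ p in C ×ˢ univ, unif {u | transform (fun t => F t p.1) p.2 u ∈ A}
          ∂(P.map fun ω => (Y ω, X ω)) := by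
        have : P.map (fun ω => ((Y ω, X ω), U ω)) = (P.map fun ω => (Y ω, X ω)).prod unif := by
          rw [← hlaw]; exact hlawX
        rw [this, ← Measure.restrict_apply hS, ← Measure.prod_restrict, Measure.restrict_univ,
          Measure.prod_apply hS]
        rfl
    _ = ∫⁻ y in C, ∫⁻ x, unif {u | transform (fun t => F t y) x u ∈ A} ∂(condDistrib X Y P y)
          ∂(P.map Y) := by
        rw [← compProd_map_condDistrib hX.aemeasurable,
          Measure.setLIntegral_compProd hh hC .univ]
        simp
    -- The inner integral no longer depends on `y`; this is the independence from `Y`.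
    _ = ∫⁻ _ in C, unif A ∂(P.map Y) :=
        lintegral_congr_ae (ae_restrict_of_ae (hF.lintegral_unif_transform hA))
    _ = (unif.prod (P.map Y)) (A ×ˢ C) := by
        rw [lintegral_const, Measure.restrict_apply_univ, Measure.prod_prod]

lemma map_condBrockwell (hX : Measurable X) (hY : Measurable Y) (hU : Measurable U)
    (hind : IndepFun (fun ω => (X ω, Y ω)) U P) (hlaw : P.map U = unif)
    (hF : IsCondDistFun P X Y F) (hm : Measurable fun p : ℝ × ℝ => F p.1 p.2)
    (hm' : Measurable fun p : ℝ × ℝ => leftLimit (fun x => F x p.2) p.1) :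
    P.map (condBrockwell F X Y U) = unif := by
  have h := congrArg Measure.fst (map_condBrockwell_prodMk hX hY hU hind hlaw hF hm hm')
  have : IsProbabilityMeasure (P.map Y) := Measure.isProbabilityMeasure_map hY.aemeasurable
  rwa [Measure.fst_map_prodMk hY, Measure.fst_prod] at h

/-- Almost surely, `X ≤ a` if and only if the Brockwell transform is at most `F(a | Y)`. -/
lemma ae_le_iff_condBrockwell_le (hX : Measurable X) (hY : Measurable Y) (hU : Measurable U)
    (hind : IndepFun (fun ω => (X ω, Y ω)) U P) (hlaw : P.map U = unif)
    (hF : IsCondDistFun P X Y F) (hm : Measurable fun p : ℝ × ℝ => F p.1 p.2)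
    (hm' : Measurable fun p : ℝ × ℝ => leftLimit (fun x => F x p.2) p.1) (a : ℝ) :
    ∀ᵐ ω ∂P, X ω ≤ a ↔ condBrockwell F X Y U ω ≤ F a (Y ω) := by
  have : IsProbabilityMeasure (P.map Y) := Measure.isProbabilityMeasure_map hY.aemeasurable
  have hZ : Measurable (condBrockwell F X Y U) := measurable_transform hm hm' hX hY hU
  have hFa : Measurable (F a) := hm.comp (measurable_const.prodMk measurable_id)
  have hsub : {ω | X ω ≤ a} ≤ᵐ[P] {ω | condBrockwell F X Y U ω ≤ F a (Y ω)} := by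
    have hUmem : ∀ᵐ ω ∂P, U ω ∈ Ioo (0 : ℝ) 1 :=
      ae_of_ae_map hU.aemeasurable (hlaw ▸ unif_ae_mem)
    filter_upwards [hUmem, ae_of_ae_map hY.aemeasurable hF] with ω hω hy hXa
    change transform (fun t => F t (Y ω)) (X ω) (U ω) ≤ F a (Y ω)
    rw [funext hy, hy a]
    exact (transform_le_cdf _ _ hω).trans (monotone_cdf _ hXa)
  -- The reverse inclusion can fail pointwise where `F(· | y)` is flat to the right of `a`; equality
  -- of probabilities shows that the difference is null.
  have hmeas : P {ω | condBrockwell F X Y U ω ≤ F a (Y ω)} ≤ P {ω | X ω ≤ a} := by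
    refine le_of_eq ?_
    have hS : MeasurableSet {p : ℝ × ℝ | p.1 ≤ F a p.2} :=
      measurableSet_le measurable_fst (hFa.comp measurable_snd)
    calc P {ω | condBrockwell F X Y U ω ≤ F a (Y ω)}
        = P.map (fun ω => (condBrockwell F X Y U ω, Y ω)) {p : ℝ × ℝ | p.1 ≤ F a p.2} :=
          (Measure.map_apply (hZ.prodMk hY) hS).symm
      _ = ∫⁻ y, unif (Iic (F a y)) ∂(P.map Y) := by
          rw [map_condBrockwell_prodMk hX hY hU hind hlaw hF hm hm', Measure.prod_apply_symm hS]
          rfl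
      _ = ∫⁻ y, condDistrib X Y P y (Iic a) ∂(P.map Y) :=
          lintegral_congr_ae (hF.unif_Iic.mono fun y hy => hy a)
      _ = P {ω | X ω ≤ a} := by
          have := setLIntegral_preimage_condDistrib (μ := P) hY hX.aemeasurable
            (measurableSet_Iic (a := a)) .univ
          rw [lintegral_map (Kernel.measurable_coe _ measurableSet_Iic) hY]
          simp only [preimage_univ, Measure.restrict_univ, univ_inter] at this
          exact this
  have := ae_eq_of_ae_subset_of_measure_ge hsub hmeas
    (measurableSet_le hX measurable_const).nullMeasurableSet (measure_ne_top _ _)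
  exact this.mem_iff

end Pair

/-! ### The unconditional transform, by conditioning on a constant. -/

/-- The constant has law `dirac 0`, so only the fibre over `0` counts; averaging `condDistrib`
against `dirac 0` shows that this fibre is the law of `X`. -/
lemma isCondDistFun_distFun_const {P : Measure Ω} [IsProbabilityMeasure P] {X : Ω → ℝ}
    (hX : Measurable X) : IsCondDistFun P X (fun _ => 0) (fun t _ => distFun P X t) := by
  have h := condDistrib_comp_map (μ := P) (X := fun _ : Ω => (0 : ℝ)) (Y := X)
    aemeasurable_const hX.aemeasurable
  rw [Measure.map_const, measure_univ, one_smul,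
    Measure.dirac_bind (Kernel.measurable _)] at h
  rw [IsCondDistFun, Measure.map_const, measure_univ, one_smul,
    ae_dirac_eq, Filter.eventually_pure]
  intro x
  rw [h]
  rfl

section Unconditional

variable {P : Measure Ω} {X U : Ω → ℝ}

/-- The unconditional Brockwell transform is conditional on a constant. -/
lemma brockwell_eq_condBrockwell (P : Measure Ω) (X U : Ω → ℝ) :
    brockwell P X U = condBrockwell (fun t _ => distFun P X t) X (fun _ => 0) U := rfl

lemma measurable_distFun (P : Measure Ω) (X : Ω → ℝ) :
    Measurable fun p : ℝ × ℝ => distFun P X p.1 :=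
  (monotone_cdf (P.map X)).measurable.comp measurable_fst

lemma measurable_leftLimit_distFun (P : Measure Ω) (X : Ω → ℝ) :
    Measurable fun p : ℝ × ℝ => leftLimit (fun x => distFun P X x) p.1 :=
  (monotone_cdf (P.map X)).leftLim.measurable.comp measurable_fst

lemma measurable_brockwell (hX : Measurable X) (hU : Measurable U) :
    Measurable (brockwell P X U) :=
  (measurable_transform_cdf (P.map X)).comp (hX.prodMk hU)

lemma indepFun_prodMk_const (hind : IndepFun X U P) :
    IndepFun (fun ω => (X ω, (0 : ℝ))) U P :=
  hind.comp (φ := fun x : ℝ => (x, (0 : ℝ))) (by fun_prop) measurable_id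

lemma map_brockwell [IsProbabilityMeasure P] (hX : Measurable X) (hU : Measurable U)
    (hind : IndepFun X U P) (hlaw : P.map U = unif) : P.map (brockwell P X U) = unif := by
  rw [brockwell_eq_condBrockwell]
  exact map_condBrockwell hX measurable_const hU (indepFun_prodMk_const hind) hlaw
    (isCondDistFun_distFun_const hX) (measurable_distFun P X) (measurable_leftLimit_distFun P X)

lemma ae_le_iff_brockwell_le [IsProbabilityMeasure P] (hX : Measurable X) (hU : Measurable U)
    (hind : IndepFun X U P) (hlaw : P.map U = unif) (a : ℝ) :
    ∀ᵐ ω ∂P, X ω ≤ a ↔ brockwell P X U ω ≤ distFun P X a := by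
  rw [brockwell_eq_condBrockwell]
  exact ae_le_iff_condBrockwell_le hX measurable_const hU (indepFun_prodMk_const hind) hlaw
    (isCondDistFun_distFun_const hX) (measurable_distFun P X) (measurable_leftLimit_distFun P X) a

end Unconditional

/-! ### Transfer of independence and the two implications. -/

/-- A random vector is independent of `X` as soon as it is independent of a variable `Z` such that
every event `{X ≤ c}` is almost surely of the form `{Z ≤ d}`. -/
lemma indepFun_of_ae_le_iff {E : Type*} [MeasurableSpace E] {P : Measure Ω}
    [IsProbabilityMeasure P] {V : Ω → E} {X Z : Ω → ℝ} (hX : Measurable X)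
    {G : ℝ → ℝ} (hind : IndepFun V Z P) (h : ∀ c, ∀ᵐ ω ∂P, X ω ≤ c ↔ Z ω ≤ G c) :
    IndepFun V X P := by
  rw [indepFun_iff_measure_inter_preimage_eq_mul]
  intro D C hD hC
  -- For fixed `D`, both sides of the product formula are finite measures in `C`, so half-lines
  -- suffice, where `X` may be replaced by `Z`.
  have hlaw : (P.restrict (V ⁻¹' D)).map X = P (V ⁻¹' D) • P.map X := by
    have : IsFiniteMeasure (P (V ⁻¹' D) • P.map X) :=
      Measure.smul_finite _ (measure_ne_top _ _)
    refine Measure.ext_of_Iic _ _ fun c => ?_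
    have hc : X ⁻¹' Iic c =ᵐ[P] Z ⁻¹' Iic (G c) := Filter.eventuallyEq_set.2 (h c)
    rw [Measure.map_apply hX measurableSet_Iic, Measure.restrict_apply (hX measurableSet_Iic),
      Measure.smul_apply, Measure.map_apply hX measurableSet_Iic, smul_eq_mul, measure_congr hc,
      measure_congr (hc.inter (Filter.EventuallyEq.refl _ (V ⁻¹' D))), inter_comm]
    exact hind.measure_inter_preimage_eq_mul D (Iic (G c)) hD measurableSet_Iic
  have := congrArg (fun m => m C) hlaw
  simp only [Measure.map_apply hX hC, Measure.restrict_apply (hX hC), Measure.smul_apply,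
    smul_eq_mul] at this
  rw [inter_comm, this]

lemma iIndepFun_vec_three {P : Measure Ω} [IsProbabilityMeasure P] {Z₁ Z₂ Z₃ : Ω → ℝ}
    (h₁ : Measurable Z₁) (h₂ : Measurable Z₂) (h₃ : Measurable Z₃)
    (h : ∀ A B C : Set ℝ, MeasurableSet A → MeasurableSet B → MeasurableSet C →
      P {ω | Z₁ ω ∈ A ∧ Z₂ ω ∈ B ∧ Z₃ ω ∈ C} = P.map Z₁ A * (P.map Z₂ B * P.map Z₃ C)) :
    iIndepFun ![Z₁, Z₂, Z₃] P := by
  have hm : ∀ i, Measurable (![Z₁, Z₂, Z₃] i) := by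
    intro i; fin_cases i <;> assumption
  rw [iIndepFun_iff_map_fun_eq_pi_map fun i => (hm i).aemeasurable]
  have : ∀ i, IsProbabilityMeasure (P.map (![Z₁, Z₂, Z₃] i)) := fun i =>
    Measure.isProbabilityMeasure_map (hm i).aemeasurable
  refine (Measure.pi_eq fun s hs => ?_).symm
  rw [Measure.map_apply (measurable_pi_lambda _ hm) (MeasurableSet.univ_pi hs),
    Fin.prod_univ_three, mul_assoc]
  refine Eq.trans ?_ (h (s 0) (s 1) (s 2) (hs 0) (hs 1) (hs 2))
  congr 1
  ext ω
  simp [Fin.forall_fin_succ]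

/-- Joint law of the Brockwell transforms of conditionally independent variables. -/
lemma measure_condBrockwell_of_condIndepGiven {P : Measure Ω} [IsProbabilityMeasure P]
    {X₁ X₂ X₃ U₁ U₂ U₃ : Ω → ℝ}
    (hX₁ : Measurable X₁) (hX₂ : Measurable X₂) (hX₃ : Measurable X₃)
    (hU₁ : Measurable U₁) (hU₂ : Measurable U₂) (hU₃ : Measurable U₃)
    (hXU : IndepFun (fun ω => (X₁ ω, X₂ ω, X₃ ω)) (fun ω => (U₁ ω, U₂ ω, U₃ ω)) P)
    (hUlaw : P.map (fun ω => (U₁ ω, U₂ ω, U₃ ω)) = unif.prod (unif.prod unif))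
    {F₁₃ F₂₃ : ℝ → ℝ → ℝ} (hF₁₃ : IsCondDistFun P X₁ X₃ F₁₃) (hF₂₃ : IsCondDistFun P X₂ X₃ F₂₃)
    (hm₁ : Measurable (fun p : ℝ × ℝ => F₁₃ p.1 p.2))
    (hm₁' : Measurable (fun p : ℝ × ℝ => leftLimit (fun x => F₁₃ x p.2) p.1))
    (hm₂ : Measurable (fun p : ℝ × ℝ => F₂₃ p.1 p.2))
    (hm₂' : Measurable (fun p : ℝ × ℝ => leftLimit (fun x => F₂₃ x p.2) p.1))
    (hCI : CondIndepGiven P X₁ X₂ X₃) {A B C : Set ℝ} (hA : MeasurableSet A)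
    (hB : MeasurableSet B) (hC : MeasurableSet C) :
    P {ω | condBrockwell F₁₃ X₁ X₃ U₁ ω ∈ A ∧ condBrockwell F₂₃ X₂ X₃ U₂ ω ∈ B ∧
      brockwell P X₃ U₃ ω ∈ C} = unif A * (unif B * unif C) := by
  have hX₃law : IsProbabilityMeasure (P.map X₃) :=
    Measure.isProbabilityMeasure_map hX₃.aemeasurable
  have hT₃ : Measurable fun p : (ℝ × ℝ × ℝ) × ℝ => transform (distFun P X₃) p.1.1 p.2 :=
    (measurable_transform_cdf (P.map X₃)).comp (measurable_fst.fst.prodMk measurable_snd)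
  have hXm' : Measurable fun ω => (X₃ ω, X₁ ω, X₂ ω) := by fun_prop
  have hXU' : IndepFun (fun ω => (X₃ ω, X₁ ω, X₂ ω)) (fun ω => (U₁ ω, U₂ ω, U₃ ω)) P :=
    hXU.comp (φ := fun p : ℝ × ℝ × ℝ => (p.2.2, p.1, p.2.1)) (by fun_prop) measurable_id
  have hT₁ : Measurable fun p : (ℝ × ℝ × ℝ) × ℝ =>
      transform (fun t => F₁₃ t p.1.1) p.1.2.1 p.2 :=
    measurable_transform hm₁ hm₁' (by fun_prop) (by fun_prop) (by fun_prop)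
  have hT₂ : Measurable fun p : (ℝ × ℝ × ℝ) × ℝ =>
      transform (fun t => F₂₃ t p.1.1) p.1.2.2 p.2 :=
    measurable_transform hm₂ hm₂' (by fun_prop) (by fun_prop) (by fun_prop)
  have hg₁ : Measurable fun p : ℝ × ℝ × ℝ => unif
      {u | transform (fun t => F₁₃ t p.1) p.2.1 u ∈ A} :=
    measurable_measure_prodMk_left (hT₁ hA)
  have hg₂ : Measurable fun p : ℝ × ℝ × ℝ => unif
      {u | transform (fun t => F₂₃ t p.1) p.2.2 u ∈ B} :=
    measurable_measure_prodMk_left (hT₂ hB)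
  have hg₃ : Measurable fun p : ℝ × ℝ × ℝ => unif
      {u | transform (distFun P X₃) p.1 u ∈ C} :=
    measurable_measure_prodMk_left (hT₃ hC)
  refine (measure_randomized hXm' hU₁ hU₂ hU₃ hXU' hUlaw
    (T₁ := fun x u => transform (fun t => F₁₃ t x.1) x.2.1 u)
    (T₂ := fun x u => transform (fun t => F₂₃ t x.1) x.2.2 u)
    (T₃ := fun x u => transform (distFun P X₃) x.1 u)
    hT₁ hT₂ hT₃ hA hB hC).trans ?_
  rw [hCI.map_eq_compProd hX₁ hX₂ hX₃, Measure.lintegral_compProd (by fun_prop)]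
  -- Over fixed `y` the third factor is a constant and the other two depend on separate coordinates
  -- of a product measure.
  have hstep : ∀ᵐ y ∂(P.map X₃), ∫⁻ x : ℝ × ℝ,
      unif {u | transform (fun t => F₁₃ t y) x.1 u ∈ A} *
      (unif {u | transform (fun t => F₂₃ t y) x.2 u ∈ B} *
        unif {u | transform (distFun P X₃) y u ∈ C})
      ∂((condDistrib X₁ X₃ P ×ₖ condDistrib X₂ X₃ P) y) =
      unif A * unif B *
        unif {u | transform (distFun P X₃) y u ∈ C} := by
    filter_upwards [hF₁₃.lintegral_unif_transform hA, hF₂₃.lintegral_unif_transform hB]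
      with y h₁ h₂
    have hy₁ : Measurable fun x => unif
        {u | transform (fun t => F₁₃ t y) x u ∈ A} :=
      -- The `0` fills a coordinate that the function ignores.
      hg₁.comp (f := fun x : ℝ => (y, x, (0 : ℝ))) (by fun_prop)
    have hy₂ : Measurable fun x => unif
        {u | transform (fun t => F₂₃ t y) x u ∈ B} :=
      hg₂.comp (f := fun x : ℝ => (y, (0 : ℝ), x)) (by fun_prop)
    simp_rw [← mul_assoc]
    rw [lintegral_mul_const' _ _ (measure_ne_top _ _),
      Kernel.prod_apply, lintegral_prod_mul hy₁.aemeasurable hy₂.aemeasurable, h₁, h₂]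
  rw [lintegral_congr_ae hstep, lintegral_const_mul' _ _
    (ENNReal.mul_ne_top (measure_ne_top _ _) (measure_ne_top _ _)), mul_assoc]
  congr 2
  exact lintegral_unif_transform_cdf (P.map X₃) hC

/-- Conditional independence from joint independence of the uniformized variables and the
conditioning variable. -/
lemma condIndepGiven_of_map_prodMk {P : Measure Ω} [IsProbabilityMeasure P]
    {X₁ X₂ X₃ Z₁ Z₂ : Ω → ℝ}
    (hX₁ : Measurable X₁) (hX₂ : Measurable X₂) (hX₃ : Measurable X₃)
    (hZ₁ : Measurable Z₁) (hZ₂ : Measurable Z₂) {F₁₃ F₂₃ : ℝ → ℝ → ℝ}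
    (hF₁₃ : IsCondDistFun P X₁ X₃ F₁₃) (hF₂₃ : IsCondDistFun P X₂ X₃ F₂₃)
    (hm₁ : Measurable (fun p : ℝ × ℝ => F₁₃ p.1 p.2))
    (hm₂ : Measurable (fun p : ℝ × ℝ => F₂₃ p.1 p.2))
    (hle₁ : ∀ a, ∀ᵐ ω ∂P, X₁ ω ≤ a ↔ Z₁ ω ≤ F₁₃ a (X₃ ω))
    (hle₂ : ∀ a, ∀ᵐ ω ∂P, X₂ ω ≤ a ↔ Z₂ ω ≤ F₂₃ a (X₃ ω))
    (hjoint : P.map (fun ω => ((Z₁ ω, Z₂ ω), X₃ ω)) = (unif.prod unif).prod (P.map X₃)) :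
    CondIndepGiven P X₁ X₂ X₃ := by
  have hX₃law : IsProbabilityMeasure (P.map X₃) :=
    Measure.isProbabilityMeasure_map hX₃.aemeasurable
  refine condIndepGiven_of_Iic hX₁ hX₂ hX₃ fun a b C hC => ?_
  have hFa : Measurable (F₁₃ a) := hm₁.comp (measurable_const.prodMk measurable_id)
  have hFb : Measurable (F₂₃ b) := hm₂.comp (measurable_const.prodMk measurable_id)
  set S : Set ((ℝ × ℝ) × ℝ) := {p | p.1.1 ≤ F₁₃ a p.2 ∧ p.1.2 ≤ F₂₃ b p.2}
  have hS : MeasurableSet S :=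
    (measurableSet_le (by fun_prop) (hFa.comp measurable_snd)).inter
      (measurableSet_le (by fun_prop) (hFb.comp measurable_snd))
  calc P (X₁ ⁻¹' Iic a ∩ X₂ ⁻¹' Iic b ∩ X₃ ⁻¹' C)
      = P ((fun ω => ((Z₁ ω, Z₂ ω), X₃ ω)) ⁻¹' (S ∩ univ ×ˢ C)) := by
        refine measure_congr (Filter.eventuallyEq_set.2 ?_)
        filter_upwards [hle₁ a, hle₂ b] with ω h₁ h₂
        simp only [mem_inter_iff, mem_preimage, mem_Iic, h₁, h₂, S, mem_ofPred_eq, mem_prod,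
          mem_univ, true_and]
    _ = ∫⁻ y in C, unif (Iic (F₁₃ a y)) * unif (Iic (F₂₃ b y))
          ∂(P.map X₃) := by
        rw [← Measure.map_apply ((hZ₁.prodMk hZ₂).prodMk hX₃)
          (hS.inter (MeasurableSet.univ.prod hC)), hjoint, ← Measure.restrict_apply hS,
          ← Measure.prod_restrict, Measure.restrict_univ, Measure.prod_apply_symm hS]
        -- The section of `S` at `y` is a product of two half-lines.
        refine lintegral_congr fun y => ?_
        rw [← Measure.prod_prod]
        rfl
    _ = _ := by
        refine lintegral_congr_ae (ae_restrict_of_ae ?_)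
        filter_upwards [hF₁₃.unif_Iic, hF₂₃.unif_Iic] with y h₁ h₂
        rw [h₁, h₂]

end Brockwell

end

/-! ### The main theorem. -/

theorem corollary2 {Ω : Type*} [MeasurableSpace Ω] (P : Measure Ω) [IsProbabilityMeasure P]
    (X₁ X₂ X₃ U₁ U₂ U₃ : Ω → ℝ)
    (hX₁ : Measurable X₁) (hX₂ : Measurable X₂) (hX₃ : Measurable X₃)
    (hU₁ : Measurable U₁) (hU₂ : Measurable U₂) (hU₃ : Measurable U₃)
    (hXU : IndepFun (fun ω => (X₁ ω, X₂ ω, X₃ ω)) (fun ω => (U₁ ω, U₂ ω, U₃ ω)) P)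
    (hU : pdf.IsUniform (fun ω => (U₁ ω, U₂ ω, U₃ ω))
      (Ioo (0 : ℝ) 1 ×ˢ Ioo (0 : ℝ) 1 ×ˢ Ioo (0 : ℝ) 1) P volume)
    (F₁₃ F₂₃ : ℝ → ℝ → ℝ)
    (hF₁₃ : Brockwell.IsCondDistFun P X₁ X₃ F₁₃)
    (hF₂₃ : Brockwell.IsCondDistFun P X₂ X₃ F₂₃)
    (hm₁ : Measurable (fun p : ℝ × ℝ => F₁₃ p.1 p.2))
    (hm₁' : Measurable (fun p : ℝ × ℝ => Brockwell.leftLimit (fun x => F₁₃ x p.2) p.1))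
    (hm₂ : Measurable (fun p : ℝ × ℝ => F₂₃ p.1 p.2))
    (hm₂' : Measurable (fun p : ℝ × ℝ => Brockwell.leftLimit (fun x => F₂₃ x p.2) p.1)) :
    (Brockwell.CondIndepGiven P X₁ X₂ X₃ →
      iIndepFun ![Brockwell.condBrockwell F₁₃ X₁ X₃ U₁, Brockwell.condBrockwell F₂₃ X₂ X₃ U₂,
        Brockwell.brockwell P X₃ U₃] P) ∧
    ((∀ᵐ x ∂(P.map X₃), Brockwell.WellOrderingCondition (fun t => F₁₃ t x) ∧
        Brockwell.WellOrderingCondition (fun t => F₂₃ t x)) →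
      Brockwell.WellOrderingCondition (Brockwell.distFun P X₃) →
      iIndepFun ![Brockwell.condBrockwell F₁₃ X₁ X₃ U₁, Brockwell.condBrockwell F₂₃ X₂ X₃ U₂,
        Brockwell.brockwell P X₃ U₃] P →
      Brockwell.CondIndepGiven P X₁ X₂ X₃) := by

  have hUlaw := Brockwell.map_eq_unif_prod hU
  have hlaw₁ : P.map U₁ = Brockwell.unif := by
    have h := congrArg Measure.fst hUlaw
    rwa [Measure.fst_map_prodMk (by fun_prop), Measure.fst_prod] at h
  have hlaw₂₃ : P.map (fun ω => (U₂ ω, U₃ ω)) = Brockwell.unif.prod Brockwell.unif := by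
    have h := congrArg Measure.snd hUlaw
    rwa [Measure.snd_map_prodMk (by fun_prop), Measure.snd_prod] at h
  have hlaw₂ : P.map U₂ = Brockwell.unif := by
    have h := congrArg Measure.fst hlaw₂₃
    rwa [Measure.fst_map_prodMk hU₃, Measure.fst_prod] at h
  have hlaw₃ : P.map U₃ = Brockwell.unif := by
    have h := congrArg Measure.snd hlaw₂₃
    rwa [Measure.snd_map_prodMk hU₂, Measure.snd_prod] at h
  have hind₁ : IndepFun (fun ω => (X₁ ω, X₃ ω)) U₁ P :=
    hXU.comp (φ := fun p : ℝ × ℝ × ℝ => (p.1, p.2.2)) (ψ := fun p : ℝ × ℝ × ℝ => p.1)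
      (by fun_prop) (by fun_prop)
  have hind₂ : IndepFun (fun ω => (X₂ ω, X₃ ω)) U₂ P :=
    hXU.comp (φ := fun p : ℝ × ℝ × ℝ => (p.2.1, p.2.2)) (ψ := fun p : ℝ × ℝ × ℝ => p.2.1)
      (by fun_prop) (by fun_prop)
  have hind₃ : IndepFun X₃ U₃ P :=
    hXU.comp (φ := fun p : ℝ × ℝ × ℝ => p.2.2) (ψ := fun p : ℝ × ℝ × ℝ => p.2.2)
      (by fun_prop) (by fun_prop)
  set Z₁ := Brockwell.condBrockwell F₁₃ X₁ X₃ U₁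
  set Z₂ := Brockwell.condBrockwell F₂₃ X₂ X₃ U₂
  set Z₃ := Brockwell.brockwell P X₃ U₃
  have hZ₁ : Measurable Z₁ := Brockwell.measurable_transform hm₁ hm₁' hX₁ hX₃ hU₁
  have hZ₂ : Measurable Z₂ := Brockwell.measurable_transform hm₂ hm₂' hX₂ hX₃ hU₂
  have hZ₃ : Measurable Z₃ := Brockwell.measurable_brockwell hX₃ hU₃
  have hZlaw₁ : P.map Z₁ = Brockwell.unif :=
    Brockwell.map_condBrockwell hX₁ hX₃ hU₁ hind₁ hlaw₁ hF₁₃ hm₁ hm₁'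
  have hZlaw₂ : P.map Z₂ = Brockwell.unif :=
    Brockwell.map_condBrockwell hX₂ hX₃ hU₂ hind₂ hlaw₂ hF₂₃ hm₂ hm₂'
  have hZlaw₃ : P.map Z₃ = Brockwell.unif := Brockwell.map_brockwell hX₃ hU₃ hind₃ hlaw₃
  refine ⟨fun hCI => ?_, fun _ _ hZind => ?_⟩
  · refine Brockwell.iIndepFun_vec_three hZ₁ hZ₂ hZ₃ fun A B C hA hB hC => ?_
    rw [hZlaw₁, hZlaw₂, hZlaw₃]
    exact Brockwell.measure_condBrockwell_of_condIndepGiven hX₁ hX₂ hX₃ hU₁ hU₂ hU₃ hXU hUlaw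
      hF₁₃ hF₂₃ hm₁ hm₁' hm₂ hm₂' hCI hA hB hC
  · have hZm : ∀ i, Measurable (![Z₁, Z₂, Z₃] i) := by
      intro i; fin_cases i <;> assumption
    have hZ₁₂ : IndepFun Z₁ Z₂ P := hZind.indepFun (i := 0) (j := 1) (by decide)
    have hZ₁₂₃ : IndepFun (fun ω => (Z₁ ω, Z₂ ω)) Z₃ P :=
      hZind.indepFun_prodMk hZm 0 1 2 (by decide) (by decide)
    -- Up to null sets, each `{X₃ ≤ c}` is an event of `Z₃`, so `X₃` inherits the independence.
    have hZX : IndepFun (fun ω => (Z₁ ω, Z₂ ω)) X₃ P :=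
      Brockwell.indepFun_of_ae_le_iff hX₃ hZ₁₂₃
        (Brockwell.ae_le_iff_brockwell_le hX₃ hU₃ hind₃ hlaw₃)
    have hjoint : P.map (fun ω => ((Z₁ ω, Z₂ ω), X₃ ω)) =
        (Brockwell.unif.prod Brockwell.unif).prod (P.map X₃) := by
      rw [hZX.map_prod_eq_prod_map_map (hZ₁.prodMk hZ₂).aemeasurable hX₃.aemeasurable,
        hZ₁₂.map_prod_eq_prod_map_map hZ₁.aemeasurable hZ₂.aemeasurable, hZlaw₁, hZlaw₂]
    exact Brockwell.condIndepGiven_of_map_prodMk hX₁ hX₂ hX₃ hZ₁ hZ₂ hF₁₃ hF₂₃ hm₁ hm₂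
      (Brockwell.ae_le_iff_condBrockwell_le hX₁ hX₃ hU₁ hind₁ hlaw₁ hF₁₃ hm₁ hm₁')
      (Brockwell.ae_le_iff_condBrockwell_le hX₂ hX₃ hU₂ hind₂ hlaw₂ hF₂₃ hm₂ hm₂') hjoint
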